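/- Let $AP$ be a finite set of atomic propositions. A trace is an infinite sequence $\mathit{tr}=P_0m_0P_1m_1\dots$ with $P_i\subseteq AP$ and $m_i\in\{\mathsf{int},\mathsf{call},\mathsf{ret}\}$. Formulae of the logic mumbling $H_\mu$ over a finite set $N$ of trace variables are given by $$\varphi ::= \exists\pi.\varphi\mid\forall\pi.\varphi\mid\psi,\qquad \psi ::= [\delta]_\pi\mid X\mid\psi\lor\psi\mid\lnot\psi\mid\bigcirc^{\Delta}\psi\mid\mu X.\psi,\qquad \delta ::= ap\mid Y\mid\delta\lor\delta\mid\lnot\delta\mid\bigcirc^{\mathsf f}\delta\mid\mu Y.\delta,$$ where $ap\in AP$, $\pi\in N$, $X,Y$ are fixpoint variables, $\mathsf f\in\{\mathsf g,\mathsf a,\mathsf c\}$ and each $\Delta$ is a successor assignment, i.e. a map from $N$ to trace formulae $\delta$; different operators $\bigcirc^{\Delta}$ in a formula may use different $\Delta$. A formula is closed if all trace variables in tests $[\delta]_\pi$ are bound by quantifiers, and all fixpoint variables (also those in tests and in successor assignments) are bound and occur positively, i.e. under an even number of negations inside their fixpoint formula. Trace formulae denote sets of positions of a trace: $ap$ holds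 at $i$ iff $ap\in P_i$; $\bigcirc^{\mathsf f}\delta$ holds at $i$ iff the $\mathsf f$-successor of $i$ exists and satisfies $\delta$; Boolean connectives are as usual, and $\mu Y.\delta$ is $\bigcap\{I\subseteq\mathbb N\mid\llbracket\delta\rrbracket_{Y\mapsto I}\subseteq I\}$. Here the $\mathsf g$-successor of $i$ is $i+1$; the $\mathsf a$-successor is $i+1$ if $m_i=\mathsf{int}$, the least $j>i$ such that positions $i,\dots,j-1$ carry equally many calls and returns if $m_i=\mathsf{call}$ and such a $j$ exists, and undefined otherwise; the $\mathsf c$-successor is the greatest $j<i$ with $m_j=\mathsf{call}$ such that positions $j+1,\dots,i-1$ carry equally many calls and returns, if one exists, and undefined otherwise. For a closed $\delta$, let $\mathrm{succ}_\delta(\mathit{tr},i)$ be the least $j>i$ at which $\delta$ holds if there is one, and $i+1$ otherwise. For an assignment of traces to the trace variables $\pi_1,\dots,\pi_n$, multitrace formulae denote subsets of $\mathbb N^n$: $[\delta]_{\pi_i}$ holds at $v$ iff $\delta$ holds at position $v_i$ of the trace of $\pi_i$; $\bigcirc^{\Delta}\psi$ holds at $v$ iff $\psi$ holds at the vector obtained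 from $v$ by moving each coordinate $v_i$ to its $\mathrm{succ}_{\Delta(\pi_i)}$-successor on the trace of $\pi_i$; Boolean connectives are as usual, and $\mu X.\psi$ is $\bigcap\{V\subseteq\mathbb N^n\mid\llbracket\psi\rrbracket_{X\mapsto V}\subseteq V\}$. For a set $\mathcal T$ of traces and a closed formula $\varphi$, $\mathcal T\models\varphi$ is defined by letting the trace quantifiers range over $\mathcal T$ and evaluating the quantifier-free part $\psi$ at $(0,\dots,0)$. A Kripke structure $\mathcal K=(S,S_0,R,L)$ has a finite set $S$ of states, initial states $S_0\subseteq S$, transitions $R\subseteq S\times S$ and labels $L:S\to2^{AP}$; $\mathit{Traces}(\mathcal K)$ consists of the traces $L(s_0)\,\mathsf{int}\,L(s_1)\,\mathsf{int}\dots$ of infinite paths $s_0s_1\dots$ with $s_0\in S_0$ and $(s_i,s_{i+1})\in R$ for all $i$. For $F\subseteq S$, $\mathit{Traces}(\mathcal K,F)$ consists of the traces of those paths that visit $F$ infinitely often. **Theorem.** Finite state model checking for mumbling $H_\mu$ is undecidable: there is no algorithm that, given a finite set $AP$, a Kripke structure $\mathcal K$ over $AP$ and a closed mumbling $H_\mu$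 formula $\varphi$ over $AP$, decides whether $\mathit{Traces}(\mathcal K)\models\varphi$. Likewise there is no algorithm that, given additionally a set $F$ of target states of $\mathcal K$, decides whether $\mathit{Traces}(\mathcal K,F)\models\varphi$. -/

import Mathlib

namespace HMu

/-! ### Traces and successor functions -/

/-- Transition symbols of traces. -/
inductive Move where
  | int
  | call
  | ret
  deriving DecidableEq

/-- The infinite trace `P₀ m₀ P₁ m₁ …`, where `prop i = Pᵢ` is a set of atomic propositions and
`move i = mᵢ` is a transition symbol. -/
structure Trace (AP : Type) where
  prop : ℕ → Set AP
  move : ℕ → Move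

/-- The successor and predecessor types: global successor, abstract successor, caller. -/
inductive Dir where
  | g
  | a
  | c
  deriving DecidableEq

namespace Trace

variable {AP : Type}

/-- Number of calls between positions `i` and `j`. -/
def calls (tr : Trace AP) (i j : ℕ) : ℕ :=
  ((Finset.Ico i j).filter fun k => tr.move k = Move.call).card

/-- Number of returns between positions `i` and `j`. -/
def rets (tr : Trace AP) (i j : ℕ) : ℕ :=
  ((Finset.Ico i j).filter fun k => tr.move k = Move.ret).card

/-- Graphs of the (partial) functions `succ_g`, `succ_a`, `succ_c`: `tr.Succ f i j` says that
`succ_f (tr, i)` is defined and equal to `j`. -/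
def Succ (tr : Trace AP) : Dir → ℕ → ℕ → Prop
  | Dir.g, i, j => j = i + 1
  | Dir.a, i, j =>
      (tr.move i = Move.int ∧ j = i + 1) ∨
      (tr.move i = Move.call ∧ IsLeast {k | i < k ∧ tr.calls i k = tr.rets i k} j)
  | Dir.c, i, j =>
      IsGreatest {k | k < i ∧ tr.move k = Move.call ∧
        tr.calls (k + 1) i = tr.rets (k + 1) i} j

end Trace

/-! ### Syntax -/

/-- Trace formulae `δ ::= ap | Y | δ ∨ δ | ¬ δ | ○^f δ | μ Y. δ`; the fixpoint variables `Y` are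
indexed by natural numbers. -/
inductive TraceFormula (AP : Type) : Type where
  | atom (p : AP)
  | var (Y : ℕ)
  | or (δ₁ δ₂ : TraceFormula AP)
  | neg (δ : TraceFormula AP)
  | next (f : Dir) (δ : TraceFormula AP)
  | mu (Y : ℕ) (δ : TraceFormula AP)

/-- Multitrace formulae `ψ ::= [δ]_π | X | ψ ∨ ψ | ¬ ψ | ○^Δ ψ | μ X. ψ` over the set `N` of trace
variables, where `Δ : N → δ` is a successor assignment. Different next operators of a formula may
use different successor assignments. -/
inductive MultiFormula (AP N : Type) : Type where
  | test (δ : TraceFormula AP) (π : N)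
  | var (X : ℕ)
  | or (ψ₁ ψ₂ : MultiFormula AP N)
  | neg (ψ : MultiFormula AP N)
  | next (Δ : N → TraceFormula AP) (ψ : MultiFormula AP N)
  | mu (X : ℕ) (ψ : MultiFormula AP N)

/-- Hyperproperty formulae `φ ::= ∃ π. φ | ∀ π. φ | ψ`. -/
inductive HyperFormula (AP N : Type) : Type where
  | ex (π : N) (φ : HyperFormula AP N)
  | all (π : N) (φ : HyperFormula AP N)
  | body (ψ : MultiFormula AP N)

/-! ### Closed formulae -/

/-- All fixpoint variables of the trace formula are bound and occur positively. The set `E` (resp.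
`O`) holds the variables bound at the current place with an even (resp. odd) number of negations
between their binder and this place. -/
def TraceFormula.ClosedIn {AP : Type} (E O : Set ℕ) : TraceFormula AP → Prop
  | .atom _ => True
  | .var Y => Y ∈ E
  | .or δ₁ δ₂ => δ₁.ClosedIn E O ∧ δ₂.ClosedIn E O
  | .neg δ => δ.ClosedIn O E
  | .next _ δ => δ.ClosedIn E O
  | .mu Y δ => δ.ClosedIn (insert Y E) (O \ {Y})

/-- Closed trace formula (every fixpoint variable is bound and occurs positively). -/
def TraceFormula.Closed {AP : Type} (δ : TraceFormula AP) : Prop := δ.ClosedIn ∅ ∅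

/-- All fixpoint variables of the multitrace formula and of its trace subformulae are bound and
occur positively, and every trace variable used in a test lies in `B`. -/
def MultiFormula.ClosedIn {AP N : Type} (B : Set N) (E O : Set ℕ) : MultiFormula AP N → Prop
  | .test δ π => δ.Closed ∧ π ∈ B
  | .var X => X ∈ E
  | .or ψ₁ ψ₂ => ψ₁.ClosedIn B E O ∧ ψ₂.ClosedIn B E O
  | .neg ψ => ψ.ClosedIn B O E
  | .next Δ ψ => (∀ π, (Δ π).Closed) ∧ ψ.ClosedIn B E O
  | .mu X ψ => ψ.ClosedIn B (insert X E) (O \ {X})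

/-- Closedness relative to the set `B` of trace variables that are already quantified. -/
def HyperFormula.ClosedIn {AP N : Type} (B : Set N) : HyperFormula AP N → Prop
  | .ex π φ => φ.ClosedIn (insert π B)
  | .all π φ => φ.ClosedIn (insert π B)
  | .body ψ => ψ.ClosedIn B ∅ ∅

/-- Closed hyperproperty formula: fixpoint variables are bound and occur positively, and trace
variables are bound by quantifiers. -/
def HyperFormula.Closed {AP N : Type} (φ : HyperFormula AP N) : Prop := φ.ClosedIn ∅

/-! ### Semantics -/

/-- `⟦δ⟧_V^tr`, the set of positions of `tr` at which `δ` holds. -/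
def TraceFormula.sem {AP : Type} (tr : Trace AP) : TraceFormula AP → (ℕ → Set ℕ) → Set ℕ
  | .atom p, _ => {i | p ∈ tr.prop i}
  | .var Y, V => V Y
  | .or δ₁ δ₂, V => δ₁.sem tr V ∪ δ₂.sem tr V
  | .neg δ, V => (δ.sem tr V)ᶜ
  | .next f δ, V => {i | ∃ j, tr.Succ f i j ∧ j ∈ δ.sem tr V}
  | .mu Y δ, V => ⋂₀ {I | δ.sem tr (Function.update V Y I) ⊆ I}

open Classical in
/-- `succ_δ (tr, i)`: the least position `j > i` satisfying `δ` if there is one, and `i + 1`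
otherwise. -/
noncomputable def TraceFormula.succ {AP : Type} (δ : TraceFormula AP) (tr : Trace AP) (i : ℕ) :
    ℕ :=
  if {j | i < j ∧ j ∈ δ.sem tr fun _ => ∅}.Nonempty then
    sInf {j | i < j ∧ j ∈ δ.sem tr fun _ => ∅}
  else i + 1

/-- Trace assignments: partial functions from trace variables to traces. -/
abbrev Assignment (AP N : Type) : Type := N → Option (Trace AP)

/-- `succ_Δ (Π, v)`. Position vectors are indexed by all of `N`; the entries outside the domain of
`Π` play no role and are left unchanged. -/
noncomputable def succAssign {AP N : Type} (Δ : N → TraceFormula AP) (A : Assignment AP N)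
    (v : N → ℕ) : N → ℕ := fun π =>
  match A π with
  | some tr => (Δ π).succ tr (v π)
  | none => v π

/-- `⟦ψ⟧_W^Π`, the set of position vectors at which `ψ` holds under the trace assignment `A`. -/
def MultiFormula.sem {AP N : Type} (A : Assignment AP N) :
    MultiFormula AP N → (ℕ → Set (N → ℕ)) → Set (N → ℕ)
  | .test δ π, _ => {v | ∃ tr, A π = some tr ∧ v π ∈ δ.sem tr fun _ => ∅}
  | .var X, W => W X
  | .or ψ₁ ψ₂, W => ψ₁.sem A W ∪ ψ₂.sem A W
  | .neg ψ, W => (ψ.sem A W)ᶜ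
  | .next Δ ψ, W => {v | succAssign Δ A v ∈ ψ.sem A W}
  | .mu X ψ, W => ⋂₀ {I | ψ.sem A (Function.update W X I) ⊆ I}

/-- `Π ⊨_T φ`. -/
def HyperFormula.Sat {AP N : Type} [DecidableEq N] (T : Set (Trace AP)) :
    HyperFormula AP N → Assignment AP N → Prop
  | .ex π φ, A => ∃ tr ∈ T, φ.Sat T (Function.update A π (some tr))
  | .all π φ, A => ∀ tr ∈ T, φ.Sat T (Function.update A π (some tr))
  | .body ψ, A => (fun _ => 0) ∈ ψ.sem A fun _ => ∅

/-- `T ⊨ φ`: satisfaction under the trace assignment with empty domain. -/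
def Models {AP N : Type} [DecidableEq N] (T : Set (Trace AP)) (φ : HyperFormula AP N) : Prop :=
  φ.Sat T fun _ => none

/-! ### Kripke structures -/

/-- A Kripke structure with set of states `S`. -/
structure KripkeStructure (AP S : Type) where
  init : Finset S
  trans : Finset (S × S)
  label : S → Finset AP

namespace KripkeStructure

variable {AP S : Type}

/-- Infinite paths that start in an initial state. -/
def paths (K : KripkeStructure AP S) : Set (ℕ → S) :=
  {p | p 0 ∈ K.init ∧ ∀ i, (p i, p (i + 1)) ∈ K.trans}

/-- Paths that visit `F` infinitely often. -/
def fairPaths (K : KripkeStructure AP S) (F : Finset S) : Set (ℕ → S) :=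
  {p | p ∈ K.paths ∧ ∃ᶠ i in Filter.atTop, p i ∈ F}

/-- The trace induced by a path; all its transition symbols are `int`. -/
def traceOf (K : KripkeStructure AP S) (p : ℕ → S) : Trace AP where
  prop i := {a | a ∈ K.label (p i)}
  move _ := Move.int

def traces (K : KripkeStructure AP S) : Set (Trace AP) := K.traceOf '' K.paths

def fairTraces (K : KripkeStructure AP S) (F : Finset S) : Set (Trace AP) :=
  K.traceOf '' K.fairPaths F

end KripkeStructure

/-! ### Encoding of finite objects by natural numbers -/

/-- Code of a finite vector of natural numbers: the code of the list of its entries. -/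
def vecCode {m : ℕ} (f : Fin m → ℕ) : ℕ := Encodable.encode (List.ofFn f)

theorem vecCode_injective {m : ℕ} : Function.Injective (vecCode : (Fin m → ℕ) → ℕ) :=
  fun _ _ h => List.ofFn_injective (Encodable.encode_injective h)

/-- Code of a subset of `Fin m`: the code of its characteristic vector. -/
def finsetCode {m : ℕ} (s : Finset (Fin m)) : ℕ := vecCode fun i => if i ∈ s then 1 else 0

theorem finsetCode_injective {m : ℕ} :
    Function.Injective (finsetCode : Finset (Fin m) → ℕ) := by
  intro s t h
  ext i
  have h2 := congrFun (vecCode_injective h) i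
  by_cases h3 : i ∈ s <;> by_cases h4 : i ∈ t <;> simp_all

def KripkeStructure.code {n m : ℕ} (K : KripkeStructure (Fin n) (Fin m)) : ℕ :=
  Nat.pair (finsetCode K.init)
    (Nat.pair (vecCode fun s => vecCode fun t => if (s, t) ∈ K.trans then 1 else 0)
      (vecCode fun s => finsetCode (K.label s)))

theorem KripkeStructure.code_injective {n m : ℕ} :
    Function.Injective (KripkeStructure.code : KripkeStructure (Fin n) (Fin m) → ℕ) := by
  rintro ⟨i, r, l⟩ ⟨i2, r2, l2⟩ h
  simp only [KripkeStructure.code, Nat.pair_eq_pair] at h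
  obtain ⟨h1, h2, h3⟩ := h
  have e1 := finsetCode_injective h1
  have e2 : r = r2 := by
    ext ⟨s, t⟩
    have h4 := congrFun (vecCode_injective (congrFun (vecCode_injective h2) s)) t
    by_cases h5 : (s, t) ∈ r <;> by_cases h6 : (s, t) ∈ r2 <;> simp_all
  have e3 : l = l2 := by
    funext s
    exact finsetCode_injective (congrFun (vecCode_injective h3) s)
  subst e1 e2 e3
  rfl

def Dir.code : Dir → ℕ
  | .g => 0
  | .a => 1
  | .c => 2

theorem Dir.code_injective : Function.Injective Dir.code := by
  intro f f' h
  cases f <;> cases f' <;> simp_all [Dir.code]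

def TraceFormula.code {n : ℕ} : TraceFormula (Fin n) → ℕ
  | .atom p => Nat.pair 0 p
  | .var Y => Nat.pair 1 Y
  | .or δ₁ δ₂ => Nat.pair 2 (Nat.pair δ₁.code δ₂.code)
  | .neg δ => Nat.pair 3 δ.code
  | .next f δ => Nat.pair 4 (Nat.pair f.code δ.code)
  | .mu Y δ => Nat.pair 5 (Nat.pair Y δ.code)

theorem TraceFormula.code_injective {n : ℕ} :
    Function.Injective (TraceFormula.code : TraceFormula (Fin n) → ℕ) := by
  intro a
  induction a with
  | atom p =>
    intro b h
    cases b <;> simp_all [TraceFormula.code, Nat.pair_eq_pair, Fin.ext_iff]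
  | var Y => intro b h; cases b <;> simp_all [TraceFormula.code, Nat.pair_eq_pair]
  | or δ₁ δ₂ h₁ h₂ =>
    intro b h
    cases b <;> simp only [TraceFormula.code, Nat.pair_eq_pair] at h <;> try omega
    rw [h₁ h.2.1, h₂ h.2.2]
  | neg δ h₁ =>
    intro b h
    cases b <;> simp only [TraceFormula.code, Nat.pair_eq_pair] at h <;> try omega
    rw [h₁ h.2]
  | next f δ h₁ =>
    intro b h
    cases b <;> simp only [TraceFormula.code, Nat.pair_eq_pair] at h <;> try omega
    rw [Dir.code_injective h.2.1, h₁ h.2.2]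
  | mu Y δ h₁ =>
    intro b h
    cases b <;> simp only [TraceFormula.code, Nat.pair_eq_pair] at h <;> try omega
    rw [h.2.1, h₁ h.2.2]

def MultiFormula.code {n k : ℕ} : MultiFormula (Fin n) (Fin k) → ℕ
  | .test δ π => Nat.pair 0 (Nat.pair δ.code π)
  | .var X => Nat.pair 1 X
  | .or ψ₁ ψ₂ => Nat.pair 2 (Nat.pair ψ₁.code ψ₂.code)
  | .neg ψ => Nat.pair 3 ψ.code
  | .next Δ ψ => Nat.pair 4 (Nat.pair (vecCode fun π => (Δ π).code) ψ.code)
  | .mu X ψ => Nat.pair 5 (Nat.pair X ψ.code)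

theorem MultiFormula.code_injective {n k : ℕ} :
    Function.Injective (MultiFormula.code : MultiFormula (Fin n) (Fin k) → ℕ) := by
  intro a
  induction a with
  | test δ π =>
    intro b h
    cases b <;> simp only [MultiFormula.code, Nat.pair_eq_pair] at h <;> try omega
    rw [TraceFormula.code_injective h.2.1, Fin.ext h.2.2]
  | var Y => intro b h; cases b <;> simp_all [MultiFormula.code, Nat.pair_eq_pair]
  | or δ₁ δ₂ h₁ h₂ =>
    intro b h
    cases b <;> simp only [MultiFormula.code, Nat.pair_eq_pair] at h <;> try omega
    rw [h₁ h.2.1, h₂ h.2.2]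
  | neg δ h₁ =>
    intro b h
    cases b <;> simp only [MultiFormula.code, Nat.pair_eq_pair] at h <;> try omega
    rw [h₁ h.2]
  | next Δ δ h₁ =>
    intro b h
    cases b <;> simp only [MultiFormula.code, Nat.pair_eq_pair] at h <;> try omega
    rename_i Δ₂ δ₂
    have e : Δ = Δ₂ := by
      funext π
      exact TraceFormula.code_injective (congrFun (vecCode_injective h.2.1) π)
    rw [e, h₁ h.2.2]
  | mu Y δ h₁ =>
    intro b h
    cases b <;> simp only [MultiFormula.code, Nat.pair_eq_pair] at h <;> try omega
    rw [h.2.1, h₁ h.2.2]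

def HyperFormula.code {n k : ℕ} : HyperFormula (Fin n) (Fin k) → ℕ
  | .ex π φ => Nat.pair 0 (Nat.pair π φ.code)
  | .all π φ => Nat.pair 1 (Nat.pair π φ.code)
  | .body ψ => Nat.pair 2 ψ.code

theorem HyperFormula.code_injective {n k : ℕ} :
    Function.Injective (HyperFormula.code : HyperFormula (Fin n) (Fin k) → ℕ) := by
  intro a
  induction a with
  | ex π φ h₁ =>
    intro b h
    cases b <;> simp only [HyperFormula.code, Nat.pair_eq_pair] at h <;> try omega
    rw [Fin.ext h.2.1, h₁ h.2.2]
  | all π φ h₁ =>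
    intro b h
    cases b <;> simp only [HyperFormula.code, Nat.pair_eq_pair] at h <;> try omega
    rw [Fin.ext h.2.1, h₁ h.2.2]
  | body ψ =>
    intro b h
    cases b <;> simp only [HyperFormula.code, Nat.pair_eq_pair] at h <;> try omega
    rw [MultiFormula.code_injective h.2]

/-! ### The model checking problems -/

/-- Input of the finite state model checking problem: finite sets of atomic propositions, states
and trace variables, a Kripke structure, and a closed hyperproperty formula. -/
structure Input where
  numAP : ℕ
  numStates : ℕ
  numVars : ℕ
  K : KripkeStructure (Fin numAP) (Fin numStates)
  φ : HyperFormula (Fin numAP) (Fin numVars)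
  closed : φ.Closed

/-- Input of the fair finite state model checking problem: additionally a set of target states. -/
structure FairInput extends Input where
  F : Finset (Fin numStates)

def Input.code (I : Input) : ℕ :=
  Nat.pair I.numAP (Nat.pair I.numStates (Nat.pair I.numVars (Nat.pair I.K.code I.φ.code)))

theorem Input.code_injective : Function.Injective Input.code := by
  rintro ⟨n, m, k, K, φ, c⟩ ⟨n2, m2, k2, K2, φ2, c2⟩ h
  simp only [Input.code, Nat.pair_eq_pair] at h
  obtain ⟨h1, h2, h3, h4, h5⟩ := h
  subst h1 h2 h3
  obtain rfl := KripkeStructure.code_injective h4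
  obtain rfl := HyperFormula.code_injective h5
  rfl

def FairInput.code (I : FairInput) : ℕ := Nat.pair I.toInput.code (finsetCode I.F)

theorem FairInput.code_injective : Function.Injective FairInput.code := by
  rintro ⟨I, F⟩ ⟨I2, F2⟩ h
  simp only [FairInput.code, Nat.pair_eq_pair] at h
  obtain rfl := Input.code_injective h.1
  obtain rfl := finsetCode_injective h.2
  rfl

/-- A decision problem `p` on a set of inputs that are given by their codes is decidable if some
computable predicate on the natural numbers gives the right answer on every code of an input. -/
def DecidableProblem {α : Type} (code : α → ℕ) (p : α → Prop) : Prop :=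
  ∃ P : ℕ → Prop, ComputablePred P ∧ ∀ x, P (code x) ↔ p x

end HMu

/-! ### A fixed finite machine whose halting on unary inputs is undecidable -/

namespace HMu
open Turing StateTransition

/-! The proof reduces halting of one fixed finite Turing machine on the inputs `a b cⁿ` to model
checking over the structure whose traces are all words. Such a machine (`exists_finite_TM0`) comes
from compiling a partial recursive function that is undecidable on powers of two, since in binary
these are unary words up to a bounded part.

A halting run uses bounded space. Its configurations, written as rows of some width `L` between
delimiters and with the halting one repeated forever, therefore form a single infinite word `u`.
Given the first row, being a run is a local condition: the letter at `t + 1 + L` is determined by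
those at `t`, `t + 1`, `t + 2` (`cellNext_rowCell`, `IsDiagram.row`). Conversely, a word with these
properties that contains a halting letter proves that the machine halts (`IsDiagram.eval_dom`,
`exists_isDiagram`).

The width depends on the run, so no fixed nesting of next operators compares letters at distance
`L`. A mumbling jump does: of two existentially quantified traces that carry `u`, one moves by a
single position and the other to its first delimiter, which stands at `L`. From then on both move in
lockstep, so the distance is kept forever and one `always` checks all windows
(`models_diagramFormula`). As every jump advances by at least one, the trace that moves by one
carries `u` behind an extra letter.

Only the description of the first row depends on `n`, by a simple recursion, so the instance is
primitive recursive in `n`. For the fair problem every state is a target. -/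

/-- There is a partial recursive function for which halting on powers of two is undecidable. -/
theorem exists_partrec_undecidable_on_powers :
    ∃ g : ℕ →. ℕ, Partrec g ∧ ¬ ComputablePred fun n : ℕ => (g (2 ^ n)).Dom := by
  have pow_prim : Primrec fun k : ℕ => 2 ^ k := by
    have h : Primrec fun k : ℕ => Nat.rec (motive := fun _ => ℕ) 1 (fun _ y => 2 * y) k :=
      Primrec.nat_rec' Primrec.id (Primrec.const 1)
        (Primrec.nat_mul.comp (Primrec.const 2) (Primrec.snd.comp Primrec.snd)).to₂
    refine h.of_eq fun k => ?_
    induction k with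
    | zero => rfl
    | succ k ih => rw [pow_succ, ← ih, mul_comm]
  let lg : ℕ →. ℕ := fun m => Nat.rfind fun k => Part.some (decide (2 ^ k = m))
  have lg_part : Partrec lg := by
    refine Partrec.rfind ?_
    have : PrimrecRel fun (m k : ℕ) => 2 ^ k = m :=
      Primrec.eq.comp (pow_prim.comp Primrec.snd) Primrec.fst
    exact this.decide.to_comp.partrec
  have lg_pow : ∀ n, lg (2 ^ n) = Part.some n := by
    intro n
    refine Part.eq_some_iff.2 (Nat.mem_rfind.2 ⟨by simp, fun {k} hk => ?_⟩)
    have : (2 : ℕ) ^ k ≠ 2 ^ n := fun h => hk.ne (Nat.pow_right_injective le_rfl h)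
    simp [this]
  -- On `2 ^ k` this runs the `k`-th program on input 0, so powers of two already carry the full
  -- halting problem.
  refine ⟨fun m => (lg m).bind fun k => (Denumerable.ofNat Nat.Partrec.Code k).eval 0,
    lg_part.bind ?_, fun h => ?_⟩
  · exact (Nat.Partrec.Code.eval_part.comp
      ((Computable.ofNat Nat.Partrec.Code).comp Computable.snd) (Computable.const 0)).to₂
  · refine ComputablePred.halting_problem 0 (ComputablePred.computable_of_manyOneReducible
      ⟨Encodable.encode, Computable.encode, fun c => ?_⟩ h)
    simp only [lg_pow, Part.bind_some, Denumerable.ofNat_encode]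

/-- Binary numerals are written with the least significant bit first, so powers of two give inputs
that grow only by repeating one letter. -/
theorem trNat_two_pow (n : ℕ) : PartrecToTM2.trNat (2 ^ n) =
    List.replicate n PartrecToTM2.Γ'.bit0 ++ [PartrecToTM2.Γ'.bit1] := by
  have h : ∀ n : ℕ, ∃ p : PosNum, (p : ℕ) = 2 ^ n ∧ PartrecToTM2.trPosNum p =
      List.replicate n PartrecToTM2.Γ'.bit0 ++ [PartrecToTM2.Γ'.bit1] := by
    intro n
    induction n with
    | zero => exact ⟨1, rfl, rfl⟩
    | succ n ih =>
      obtain ⟨p, h1, h2⟩ := ih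
      refine ⟨p.bit0, ?_, ?_⟩
      · rw [PosNum.cast_bit0, h1]; ring
      · rw [PartrecToTM2.trPosNum, h2]; rfl
  obtain ⟨p, h1, h2⟩ := h n
  have : ((2 ^ n : ℕ) : Num) = Num.pos p := by
    rw [← h1]
    exact Num.of_to_nat (Num.pos p)
  rw [PartrecToTM2.trNat, this, PartrecToTM2.trNum, h2]

/-- Chains the simulations from partial recursive functions through stack machines to one-tape
machines. The resulting state type may be infinite, but a finite set of states supports the machine.
-/
theorem exists_TM0_supports : ∃ (Γ Λ : Type) (_ : Inhabited Γ) (_ : Inhabited Λ) (_ : Finite Γ)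
    (M : TM0.Machine Γ Λ) (S : Finset Λ) (a b c : Γ), TM0.Supports M (S : Set Λ) ∧
    ¬ ComputablePred fun n : ℕ =>
      (eval (TM0.step M) (TM0.init (a :: b :: List.replicate n c))).Dom := by
  obtain ⟨g, hg, hund⟩ := exists_partrec_undecidable_on_powers
  obtain ⟨C, hC⟩ := ToPartrec.Code.exists_code (Nat.Partrec'.part_iff₁.2 hg)
  let _ : Inhabited PartrecToTM2.Λ' := ⟨PartrecToTM2.trNormal C .halt⟩
  let _ : Fintype PartrecToTM2.K' :=
    ⟨{.main, .rev, .aux, .stack}, fun x => by cases x <;> simp⟩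
  let M2 : PartrecToTM2.Λ' → TM2.Stmt (fun _ : PartrecToTM2.K' => PartrecToTM2.Γ')
    PartrecToTM2.Λ' (Option PartrecToTM2.Γ') := PartrecToTM2.tr
  have s2 : TM2.Supports M2 (PartrecToTM2.codeSupp C .halt) := PartrecToTM2.tr_supports C .halt
  have s0 := TM1to0.tr_supports (TM2to1.tr M2) (TM2to1.tr_supports M2 s2)
  let sym : PartrecToTM2.Γ' → TM2to1.Γ' PartrecToTM2.K' (fun _ => PartrecToTM2.Γ') := fun x =>
    (false, Function.update (fun _ => none) .main (some x))
  refine ⟨_, _, inferInstance, inferInstance, Finite.of_fintype _, TM1to0.tr (TM2to1.tr M2), _,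
    (true, (sym .cons).2), sym .bit1, sym .bit0, s0, ?_⟩
  refine fun h => hund (h.of_eq fun n => ?_)
  have e1 : (true, (sym .cons).2) :: sym .bit1 :: List.replicate n (sym .bit0) =
      TM2to1.trInit (Γ := fun _ => PartrecToTM2.Γ') PartrecToTM2.K'.main
        (PartrecToTM2.trList [2 ^ n]) := by
    -- The stack is laid out from its bottom, which reverses the numeral: the repeated bits come
    -- last. The first cell also carries the bottom marker.
    have e : (PartrecToTM2.trList [2 ^ n]).reverse =
        .cons :: .bit1 :: List.replicate n .bit0 := by
      simp [PartrecToTM2.trList, trNat_two_pow]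
    rw [TM2to1.trInit, e]
    change _ = _ :: sym .bit1 :: List.map sym (List.replicate n .bit0)
    rw [List.map_replicate]
    rfl
  have e2 : (TM2.init PartrecToTM2.K'.main (PartrecToTM2.trList [2 ^ n]) :
      TM2.Cfg (fun _ : PartrecToTM2.K' => PartrecToTM2.Γ') PartrecToTM2.Λ'
        (Option PartrecToTM2.Γ')) = PartrecToTM2.init C [2 ^ n] := by
    simp only [TM2.init, PartrecToTM2.init]
    congr 1
    funext k
    cases k <;> simp [PartrecToTM2.K'.elim]
  have h0 : (TM0.eval (TM1to0.tr (TM2to1.tr M2)) (TM2to1.trInit PartrecToTM2.K'.main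
      (PartrecToTM2.trList [2 ^ n]))).Dom ↔ (TM2.eval M2 PartrecToTM2.K'.main
      (PartrecToTM2.trList [2 ^ n])).Dom := by
    rw [TM1to0.tr_eval, TM2to1.tr_eval_dom]
  refine (iff_of_eq (congrArg (fun l => (eval (TM0.step (TM1to0.tr (TM2to1.tr M2)))
    (TM0.init l)).Dom) e1)).trans (h0.trans ?_)
  have h1 : (TM2.eval M2 PartrecToTM2.K'.main (PartrecToTM2.trList [2 ^ n])).Dom ↔
      (eval (TM2.step M2) (PartrecToTM2.init C [2 ^ n])).Dom := by
    rw [← e2]; rfl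
  have h2 := hC ⟨[2 ^ n], rfl⟩
  rw [h1, show eval (TM2.step M2) (PartrecToTM2.init C [2 ^ n]) = _ from
    PartrecToTM2.tr_eval C [2 ^ n], h2]
  rfl

/-- A fixed finite Turing machine with an undecidable set of unary inputs on which it halts. -/
theorem exists_finite_TM0 : ∃ (Γ Λ : Type) (_ : Inhabited Γ) (_ : Inhabited Λ) (_ : Finite Γ)
    (_ : Finite Λ) (M : TM0.Machine Γ Λ) (a b c : Γ), ¬ ComputablePred fun n : ℕ =>
      (eval (TM0.step M) (TM0.init (a :: b :: List.replicate n c))).Dom := by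
  classical
  obtain ⟨Γ, Λ, _, _, _, M, S, a, b, c, hS, h⟩ := exists_TM0_supports
  let _ : Inhabited S := ⟨⟨default, hS.1⟩⟩
  -- A retraction onto the supporting states; its value elsewhere does not matter, because the run
  -- never leaves `S`.
  let g₁ : PointedMap Λ S := ⟨fun q => if hq : q ∈ S then ⟨q, hq⟩ else default, by
    have : (default : Λ) ∈ S := hS.1
    simp only [this, dite_true]; rfl⟩
  let f : PointedMap Γ Γ := ⟨id, rfl⟩
  refine ⟨Γ, S, inferInstance, inferInstance, inferInstance, inferInstance,
    TM0.Machine.map M f f g₁ Subtype.val, a, b, c, fun h' => h (h'.of_eq fun n => ?_)⟩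
  have hr := TM0.Machine.map_respects M f f g₁ Subtype.val hS (fun _ => rfl) (fun q hq => by
    have : q ∈ S := hq
    simp [g₁, this])
  refine tr_eval_dom hr ⟨hS.1, ?_⟩
  rw [TM0.map_init]
  simp [f]
end HMu

namespace HMu
open Turing StateTransition

/-! ### Space-time diagrams of Turing machines wound up to infinite words -/

/-- Letters of space-time diagrams: a delimiter `none`, or a tape symbol together with the state of
the machine if the head is at this place. -/
abbrev Cell (Γ Q : Type) : Type := Option (Γ × Option Q)

section SpaceTime

variable {Γ Q : Type} [Inhabited Γ]

/-- The row of width `L` that shows the configuration `C` with the head at place `p`. -/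
def rowCell (C : TM0.Cfg Γ Q) (p : ℤ) (L : ℕ) (j : ℤ) : Cell Γ Q :=
  if j = 0 ∨ j = L then none else some (C.Tape.nth (j - p), if j = p then some C.q else none)

theorem rowCell_of_mem {C : TM0.Cfg Γ Q} {p : ℤ} {L : ℕ} {j : ℤ} (h0 : 0 < j) (h1 : j < L) :
    rowCell C p L j = some (C.Tape.nth (j - p), if j = p then some C.q else none) := by
  rw [rowCell, if_neg]; omega

theorem rowCell_zero {C : TM0.Cfg Γ Q} {p : ℤ} {L : ℕ} : rowCell C p L 0 = none := by
  simp [rowCell]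

theorem rowCell_width {C : TM0.Cfg Γ Q} {p : ℤ} {L : ℕ} : rowCell C p L L = none := by
  simp [rowCell]

variable [Inhabited Q] (M : TM0.Machine Γ Q)

/-- The state in which the head leaves the cell in direction `d`. -/
def leaves (d : Turing.Dir) : Cell Γ Q → Option Q
  | some (γ, some q) =>
    match M q γ with
    | some (q', .move d') => if d' = d then some q' else none
    | _ => none
  | _ => none

/-- The successor of the cell `c` between `l` and `r`. The head may not be next to a delimiter. -/
def cellNext (l c r : Cell Γ Q) : Option (Cell Γ Q) :=
  match c with
  | none => some none
  | some (γ, none) => some (some (γ, (leaves M .right l).or (leaves M .left r)))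
  | some (γ, some q) =>
    if l.isNone || r.isNone then none else
    match M q γ with
    | none => some (some (γ, some q))
    | some (q', .write b) => some (some (b, some q'))
    | some (_, .move _) => some (some (γ, none))

def CellHalts (c : Cell Γ Q) : Prop := ∃ γ q, c = some (γ, some q) ∧ M q γ = none

/-- The movement of the head in the next step. -/
def headShift (C : TM0.Cfg Γ Q) : ℤ :=
  match M C.q C.Tape.head with
  | some (_, .move .right) => 1
  | some (_, .move .left) => -1
  | _ => 0

/-- Halted configurations are repeated, so that every run is infinite. -/
def nextCfg (C : TM0.Cfg Γ Q) : TM0.Cfg Γ Q := (TM0.step M C).getD C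

/-- The configuration and the position of the head after `i` steps. -/
def runFrom (C : TM0.Cfg Γ Q) (p : ℤ) : ℕ → TM0.Cfg Γ Q × ℤ
  | 0 => (C, p)
  | i + 1 => (nextCfg M (runFrom C p i).1, (runFrom C p i).2 + headShift M (runFrom C p i).1)

/-- Only the cell at `p` carries a state, so at most one neighbour can send the head into a given
cell. -/
theorem leaves_rowCell {C : TM0.Cfg Γ Q} {p : ℤ} {L : ℕ} (d : Turing.Dir) (k : ℤ)
    (hp : 0 < p) (hpL : p < L) : leaves M d (rowCell C p L k) =
      if k = p then leaves M d (some (C.Tape.head, some C.q)) else none := by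
  by_cases hk : k = p
  · subst hk
    rw [rowCell_of_mem hp hpL]
    simp
  · rw [rowCell]
    split_ifs <;> simp [leaves]

/-- The head moves by at most one cell per step, so the new content of a cell depends only on the
cell and its two neighbours. The bounds on `p` keep the head away from the delimiters, where
`cellNext` is undefined. -/
theorem cellNext_rowCell {C : TM0.Cfg Γ Q} {p : ℤ} {L : ℕ} {j : ℤ}
    (hp : 1 < p) (hpL : p + 1 < L) (h0 : 0 < j) (h1 : j < L) :
    cellNext M (rowCell C p L (j - 1)) (rowCell C p L j) (rowCell C p L (j + 1)) =
      some (rowCell (nextCfg M C) (p + headShift M C) L j) := by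
  obtain ⟨q, T⟩ := C
  rw [rowCell_of_mem h0 h1, rowCell_of_mem h0 h1]
  by_cases hj : j = p
  · subst hj
    have e1 : (rowCell ⟨q, T⟩ j L (j - 1)).isNone = false := by
      rw [rowCell_of_mem (by omega) (by omega)]; rfl
    have e2 : (rowCell ⟨q, T⟩ j L (j + 1)).isNone = false := by
      rw [rowCell_of_mem (by omega) (by omega)]; rfl
    rcases h : M q T.head with _ | ⟨q', d | b⟩
    · simp [cellNext, e1, e2, h, nextCfg, headShift, TM0.step]
    · cases d <;>
        simp [cellNext, e1, e2, h, nextCfg, headShift, TM0.step, Tape.move_left_nth,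
          Tape.move_right_nth]
    · simp [cellNext, e1, e2, h, nextCfg, headShift, TM0.step]
      rfl
  · rw [if_neg hj]
    simp only [cellNext, leaves_rowCell M _ _ (by omega : 0 < p) (by omega : p < L)]
    rcases h : M q T.head with _ | ⟨q', d | b⟩
    · simp [h, nextCfg, headShift, TM0.step, leaves, hj]
    · cases d
      · have : (j = p + -1) ↔ (j + 1 = p) := by omega
        have e : j - (p + -1) - 1 = j - p := by ring
        simp [h, nextCfg, headShift, TM0.step, leaves, Tape.move_left_nth, this, e]
      · have : (j = p + 1) ↔ (j - 1 = p) := by omega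
        have e : j - (p + 1) + 1 = j - p := by ring
        simp [h, nextCfg, headShift, TM0.step, leaves, Tape.move_right_nth, this, e]
    · have : j - p ≠ 0 := by omega
      simp [h, nextCfg, headShift, TM0.step, leaves, hj, Tape.write_nth, this]

theorem step_eq_none_iff {C : TM0.Cfg Γ Q} : TM0.step M C = none ↔ M C.q C.Tape.head = none := by
  obtain ⟨q, T⟩ := C
  simp [TM0.step]

theorem reaches_runFrom (C : TM0.Cfg Γ Q) (p : ℤ) (i : ℕ) :
    StateTransition.Reaches (TM0.step M) C (runFrom M C p i).1 := by
  induction i with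
  | zero => exact Relation.ReflTransGen.refl
  | succ i ih =>
    rw [runFrom, nextCfg]
    rcases h : TM0.step M (runFrom M C p i).1 with _ | C'
    · exact ih
    · exact ih.tail h

theorem exists_runFrom_of_reaches {C C' : TM0.Cfg Γ Q} (p : ℤ)
    (h : StateTransition.Reaches (TM0.step M) C C') : ∃ i, (runFrom M C p i).1 = C' := by
  induction h with
  | refl => exact ⟨0, rfl⟩
  | tail _ h ih =>
    obtain ⟨i, rfl⟩ := ih
    refine ⟨i + 1, ?_⟩
    rw [runFrom, nextCfg, show TM0.step M _ = some _ from h]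
    rfl

theorem eval_dom_iff (C : TM0.Cfg Γ Q) (p : ℤ) :
    (eval (TM0.step M) C).Dom ↔ ∃ i, TM0.step M (runFrom M C p i).1 = none := by
  constructor
  · intro h
    obtain ⟨h1, h2⟩ := mem_eval.1 (Part.get_mem h)
    obtain ⟨i, hi⟩ := exists_runFrom_of_reaches M p h1
    exact ⟨i, by rw [hi]; exact h2⟩
  · rintro ⟨i, hi⟩
    exact Part.dom_iff_mem.2 ⟨_, mem_eval.2 ⟨reaches_runFrom M C p i, hi⟩⟩

/-! ### Diagrams exist exactly for halting runs -/

/-- The word `u` is a space-time diagram of width `L` of a halting run from `C`, whose head is at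
place `p` in the beginning. -/
structure IsDiagram (C : TM0.Cfg Γ Q) (u : ℕ → Cell Γ Q) (L p : ℕ) : Prop where
  pos : 0 < p
  lt : p < L
  init : ∀ k ≤ L, u k = rowCell C p L k
  next : ∀ t, cellNext M (u t) (u (t + 1)) (u (t + 2)) = some (u (t + 1 + L))
  halts : ∃ t, CellHalts M (u t)

variable {M}

/-- The local rule propagates rows: row `i` shows the configuration after `i` steps. Column `L` of a
row is column 0 of the next one. -/
theorem IsDiagram.row {C : TM0.Cfg Γ Q} {u : ℕ → Cell Γ Q} {L p : ℕ} (h : IsDiagram M C u L p)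
    (i : ℕ) : 0 < (runFrom M C p i).2 ∧ (runFrom M C p i).2 < L ∧ ∀ j ≤ L,
      u (i * L + j) = rowCell (runFrom M C p i).1 (runFrom M C p i).2 L j := by
  induction i with
  | zero => exact ⟨by simpa [runFrom] using h.pos, by simpa [runFrom] using h.lt, by
      simpa [runFrom] using h.init⟩
  | succ i ih =>
    obtain ⟨h0, h1, hr⟩ := ih
    rw [runFrom]
    generalize (runFrom M C p i).1 = D at *
    generalize (runFrom M C p i).2 = x at *
    have window : ∀ j, 0 < j → j < L → cellNext M (rowCell D x L ((j : ℤ) - 1)) (rowCell D x L j)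
        (rowCell D x L ((j : ℤ) + 1)) = some (u ((i + 1) * L + j)) := by
      intro j hj0 hjL
      have e := h.next (i * L + (j - 1))
      rw [show i * L + (j - 1) + 1 = i * L + j by omega,
        show i * L + (j - 1) + 2 = i * L + (j + 1) by omega, hr _ (by omega), hr _ hjL.le,
        hr _ (by omega), show i * L + j + L = (i + 1) * L + j by ring] at e
      rw [← e]
      push_cast [Nat.cast_sub (show 1 ≤ j from hj0)]
      rfl
    -- Next to a delimiter the window around the head would have no successor, contradicting
    -- `window`; hence the head cannot leave the row in the next step.
    have inner : 1 < x ∧ x + 1 < L := by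
      have e := window x.toNat (by omega) (by omega)
      rw [show ((x.toNat : ℕ) : ℤ) = x by omega, rowCell_of_mem h0 h1, if_pos rfl] at e
      constructor
      · by_contra hx
        rw [show x - 1 = 0 by omega, rowCell_zero] at e
        simp [cellNext] at e
      · by_contra hx
        rw [show x + 1 = L by omega, rowCell_width] at e
        simp [cellNext] at e
    have bound : -1 ≤ headShift M D ∧ headShift M D ≤ 1 := by
      rw [headShift]; split <;> simp
    have start : u ((i + 1) * L) = none := by
      have := hr L le_rfl
      rwa [rowCell_width, show i * L + L = (i + 1) * L by ring] at this
    refine ⟨by omega, by omega, fun j hj => ?_⟩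
    rcases Nat.eq_zero_or_pos j with rfl | hj0
    · simp [rowCell_zero, start]
    · rcases hj.eq_or_lt with rfl | hjL
      -- The delimiter that ends row `i` is copied `L` places further, where it ends row `i + 1`.
      · have e := h.next ((i + 1) * j - 1)
        have : 0 < (i + 1) * j := by positivity
        rw [show (i + 1) * j - 1 + 1 = (i + 1) * j by omega, start] at e
        rw [rowCell_width]
        simpa [cellNext, eq_comm] using e
      · have e := window j hj0 hjL
        rw [cellNext_rowCell M inner.1 inner.2 (by omega) (by omega)] at e
        exact (Option.some.inj e).symm

theorem IsDiagram.eval_dom {C : TM0.Cfg Γ Q} {u : ℕ → Cell Γ Q} {L p : ℕ}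
    (h : IsDiagram M C u L p) : (eval (TM0.step M) C).Dom := by
  rw [eval_dom_iff M C p]
  obtain ⟨t, γ, q, hu, hM⟩ := h.halts
  have hL : 0 < L := h.pos.trans h.lt
  refine ⟨t / L, ?_⟩
  obtain ⟨h0, h1, hr⟩ := h.row (t / L)
  have e := hr (t % L) (Nat.mod_lt t hL).le
  rw [mul_comm, Nat.div_add_mod, hu, rowCell] at e
  split_ifs at e with h2 h3
  · simp only [Option.some.injEq, Prod.mk.injEq] at e
    rw [step_eq_none_iff, ← e.2, ← hM, e.1, h3, sub_self]
    rfl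
  · simp at e

/-- A run that halts after `N` steps keeps its head within distance `N` of the start, so a wide
enough row holds it. The parameter `n` reserves room for the input. -/
theorem exists_isDiagram {C : TM0.Cfg Γ Q} (h : (eval (TM0.step M) C).Dom) (n : ℕ) :
    ∃ u L p, IsDiagram M C u L p ∧ p + n < L := by
  obtain ⟨N, hN⟩ : ∃ N : ℕ, ∀ p, TM0.step M (runFrom M C p N).1 = none := by
    have indep : ∀ (p p' : ℤ) i, (runFrom M C p i).1 = (runFrom M C p' i).1 := by
      intro p p' i
      induction i with
      | zero => rfl
      | succ i ih => rw [runFrom, runFrom, ih]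
    obtain ⟨N, hN⟩ := (eval_dom_iff M C 0).1 h
    exact ⟨N, fun p => by rw [indep p 0]; exact hN⟩
  -- The head stays between `p - N = 2` and `p + N < L - 1`, never next to a delimiter.
  obtain ⟨p, hp⟩ : ∃ p, p = N + 2 := ⟨_, rfl⟩
  obtain ⟨L, hL⟩ : ∃ L, L = p + N + n + 3 := ⟨_, rfl⟩
  replace hN := hN p
  -- The distance grows by at most one per step, and from step `N` on the machine has halted and the
  -- head rests.
  have bound : ∀ i : ℕ, |(runFrom M C p i).2 - p| ≤ i ∧ |(runFrom M C p i).2 - p| ≤ N ∧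
      (N ≤ i → TM0.step M (runFrom M C p i).1 = none) := by
    intro i
    induction i with
    | zero =>
      refine ⟨by simp [runFrom], by simp [runFrom], fun h => ?_⟩
      rwa [Nat.le_zero.1 h] at hN
    | succ i ih =>
      obtain ⟨h1, h2, h3⟩ := ih
      have hs : |headShift M (runFrom M C p i).1| ≤ 1 := by
        rw [headShift]; split <;> simp
      have hlast : N ≤ i + 1 → TM0.step M (runFrom M C p (i + 1)).1 = none := by
        intro hi
        rcases hi.eq_or_lt with rfl | hi
        · exact hN
        · rw [runFrom, nextCfg, h3 (by omega)]
          exact h3 (by omega)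
      rw [abs_le] at h1 h2 hs
      have hstep : (runFrom M C p (i + 1)).2 =
        (runFrom M C p i).2 + headShift M (runFrom M C p i).1 := rfl
      refine ⟨?_, ?_, hlast⟩
      · rw [abs_le]; push_cast; omega
      · rw [abs_le]
        by_cases hi : i < N
        · omega
        · have : headShift M (runFrom M C p i).1 = 0 := by
            rw [headShift, (step_eq_none_iff M).1 (h3 (by omega))]
          omega
  let u : ℕ → Cell Γ Q := fun k =>
    rowCell (runFrom M C p (k / L)).1 (runFrom M C p (k / L)).2 L ((k % L : ℕ) : ℤ)
  have hu : ∀ i j, j ≤ L → u (i * L + j) =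
      rowCell (runFrom M C p i).1 (runFrom M C p i).2 L j := by
    intro i j hj
    rcases hj.eq_or_lt with rfl | hj
    · rw [rowCell_width]
      simp only [u]
      rw [show i * j + j = (i + 1) * j by ring, Nat.mul_mod_left]
      exact rowCell_zero
    · simp only [u]
      rw [mul_comm, Nat.mul_add_mod, Nat.mod_eq_of_lt hj, Nat.mul_add_div (by omega),
        Nat.div_eq_of_lt hj, add_zero]
  refine ⟨u, L, p, ⟨by omega, by omega, fun k hk => ?_, fun t => ?_, N * L +
    ((runFrom M C p N).2).toNat, ?_⟩, by omega⟩
  · have := hu 0 k hk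
    rwa [zero_mul, zero_add] at this
  · obtain ⟨i, j, hj, hij⟩ : ∃ i j, j < L ∧ t + 1 = i * L + j :=
      ⟨(t + 1) / L, (t + 1) % L, Nat.mod_lt _ (by omega), (Nat.div_add_mod' _ _).symm⟩
    have e2 : u (t + 1 + L) = u ((i + 1) * L + j) := by rw [hij]; congr 1; ring
    rcases Nat.eq_zero_or_pos j with rfl | hj0
    · rw [e2, hij, hu _ _ (by omega), hu _ _ (by omega)]
      simp [rowCell_zero, cellNext]
    · have b := (bound i).2.1
      rw [abs_le] at b
      rw [e2, hij, show t = i * L + (j - 1) by omega,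
        show i * L + (j - 1) + 2 = i * L + (j + 1) by omega, hu _ _ (by omega), hu _ _ hj.le,
        hu _ _ (by omega), hu _ _ hj.le]
      have := cellNext_rowCell M (C := (runFrom M C p i).1) (p := (runFrom M C p i).2) (L := L)
        (j := j) (by omega) (by omega) (by omega) (by omega)
      push_cast [Nat.cast_sub (show 1 ≤ j from hj0)]
      exact this
  · have b := (bound N).2.1
    rw [abs_le] at b
    rw [hu _ _ (by omega), show (((runFrom M C p N).2.toNat : ℕ) : ℤ) = (runFrom M C p N).2 by
      omega, rowCell_of_mem (by omega) (by omega), if_pos rfl, sub_self]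
    exact ⟨_, _, rfl, (step_eq_none_iff M).1 hN⟩

end SpaceTime
end HMu

namespace HMu

/-! ### Derived operators -/

/-- The trace formula `μ Y. Y`, which holds nowhere. The `δ`-successor for this formula is the next
position. -/
def TraceFormula.bot {AP : Type} : TraceFormula AP := .mu 0 (.var 0)

/-- The atom `a` holds `i` positions later. -/
def TraceFormula.later {AP : Type} (i : ℕ) (a : AP) : TraceFormula AP :=
  (TraceFormula.next Dir.g)^[i] (.atom a)

namespace MultiFormula

variable {AP N : Type}

def and (ψ₁ ψ₂ : MultiFormula AP N) : MultiFormula AP N := .neg (.or (.neg ψ₁) (.neg ψ₂))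

def bot : MultiFormula AP N := .mu 0 (.var 0)

/-- Move all positions by one. -/
def step (ψ : MultiFormula AP N) : MultiFormula AP N := .next (fun _ => .bot) ψ

def eventually (ψ : MultiFormula AP N) : MultiFormula AP N := .mu 0 (.or ψ (step (.var 0)))

def always (ψ : MultiFormula AP N) : MultiFormula AP N := .neg (eventually (.neg ψ))

def bigOr (l : List (MultiFormula AP N)) : MultiFormula AP N := l.foldr .or bot

end MultiFormula

/-! ### Semantics of the derived operators on words -/

/-- The trace with the single atom `w i` at position `i`. -/
def wordTrace {AP : Type} (w : ℕ → AP) : Trace AP where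
  prop i := {a | a = w i}
  move _ := Move.int

theorem bot_sem {AP : Type} (tr : Trace AP) (V : ℕ → Set ℕ) :
    TraceFormula.bot.sem tr V = ∅ := by
  refine Set.eq_empty_of_forall_notMem fun i hi => ?_
  exact hi ∅ (by simp [TraceFormula.sem])

theorem mem_later_sem {AP : Type} (w : ℕ → AP) (i : ℕ) (a : AP) (V : ℕ → Set ℕ) (x : ℕ) :
    x ∈ (TraceFormula.later i a).sem (wordTrace w) V ↔ a = w (x + i) := by
  induction i generalizing x with
  | zero => rfl
  | succ i ih =>
    rw [TraceFormula.later, Function.iterate_succ_apply']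
    simp only [TraceFormula.sem, Trace.Succ, Set.mem_ofPred_eq, exists_eq_left]
    rw [← TraceFormula.later, ih, Nat.add_right_comm, add_assoc]

theorem bot_succ {AP : Type} (tr : Trace AP) (i : ℕ) : TraceFormula.bot.succ tr i = i + 1 := by
  simp [TraceFormula.succ, bot_sem]

theorem lt_succ {AP : Type} (δ : TraceFormula AP) (tr : Trace AP) (i : ℕ) : i < δ.succ tr i := by
  rw [TraceFormula.succ]
  split_ifs with h
  · exact (Nat.sInf_mem h).1
  · exact i.lt_succ_self

theorem notMem_of_lt_succ {AP : Type} {δ : TraceFormula AP} {tr : Trace AP} {i k : ℕ} (hi : i < k)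
    (hk : k < δ.succ tr i) : k ∉ δ.sem tr fun _ => ∅ := by
  intro hm
  rw [TraceFormula.succ, if_pos ⟨k, hi, hm⟩] at hk
  exact Nat.notMem_of_lt_sInf hk ⟨hi, hm⟩

theorem succ_eq {AP : Type} {δ : TraceFormula AP} {tr : Trace AP} {i j : ℕ} (hi : i < j)
    (hj : j ∈ δ.sem tr fun _ => ∅) (h : ∀ k, i < k → k < j → k ∉ δ.sem tr fun _ => ∅) :
    δ.succ tr i = j := by
  rw [TraceFormula.succ, if_pos ⟨j, hi, hj⟩]
  refine le_antisymm (Nat.sInf_le ⟨hi, hj⟩) (not_lt.1 fun hlt => ?_)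
  have hm := Nat.sInf_mem (s := {j | i < j ∧ j ∈ δ.sem tr fun _ => ∅}) ⟨j, hi, hj⟩
  exact h _ hm.1 hlt hm.2

/-- The total trace assignment given by words. -/
def wordAssign {AP N : Type} (w : N → ℕ → AP) : Assignment AP N := fun π => some (wordTrace (w π))

namespace MultiFormula

variable {AP N : Type} (w : N → ℕ → AP) (W : ℕ → Set (N → ℕ)) (v : N → ℕ)

theorem mem_and_sem (A : Assignment AP N) (ψ₁ ψ₂ : MultiFormula AP N) :
    v ∈ (and ψ₁ ψ₂).sem A W ↔ v ∈ ψ₁.sem A W ∧ v ∈ ψ₂.sem A W := by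
  simp [and, sem]

theorem mem_bigOr_sem (A : Assignment AP N) (l : List (MultiFormula AP N)) :
    v ∈ (bigOr l).sem A W ↔ ∃ ψ ∈ l, v ∈ ψ.sem A W := by
  induction l with
  | nil =>
    simp only [List.not_mem_nil, false_and, exists_false, iff_false]
    exact fun h => h ∅ (by simp [sem])
  | cons ψ l ih =>
    change v ∈ ψ.sem A W ∪ (bigOr l).sem A W ↔ _
    simp [ih]

theorem mem_step_sem (ψ : MultiFormula AP N) : v ∈ (step ψ).sem (wordAssign w) W ↔
    (fun π => v π + 1) ∈ ψ.sem (wordAssign w) W := by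
  have : succAssign (fun _ => TraceFormula.bot) (wordAssign w) v = fun π => v π + 1 := by
    funext π
    simp [succAssign, wordAssign, bot_succ]
  simp [step, sem, this]

theorem mem_test_later_sem (i : ℕ) (a : AP) (π : N) :
    v ∈ (test (.later i a) π).sem (wordAssign w) W ↔ a = w π (v π + i) := by
  simp [sem, wordAssign, mem_later_sem]

/-- The set on the right is a prefixed point, and induction on `t` puts it inside every other one.
Independence of `W` is required because `eventually` binds the variable 0, which must not be
captured in `ψ`. -/
theorem mem_eventually_sem {ψ : MultiFormula AP N}
    (h : ∀ W W', ψ.sem (wordAssign w) W = ψ.sem (wordAssign w) W') :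
    v ∈ (eventually ψ).sem (wordAssign w) W ↔
      ∃ t : ℕ, (fun π => v π + t) ∈ ψ.sem (wordAssign w) W := by
  have unfold_sem : (eventually ψ).sem (wordAssign w) W =
      ⋂₀ {I | ψ.sem (wordAssign w) W ∪ {v | (fun π => v π + 1) ∈ I} ⊆ I} := by
    simp only [eventually, sem]
    congr 1
    ext I
    have : (step (.var 0)).sem (wordAssign w) (Function.update W 0 I) =
        {v | (fun π => v π + 1) ∈ I} := by
      ext v
      rw [mem_step_sem]
      simp [sem]
    rw [Set.mem_ofPred_eq, Set.mem_ofPred_eq, this, h (Function.update W 0 I) W]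
  rw [unfold_sem]
  constructor
  · intro hv
    refine hv {v | ∃ t : ℕ, (fun π => v π + t) ∈ ψ.sem (wordAssign w) W} ?_
    rintro v (hv | ⟨t, ht⟩)
    · exact ⟨0, hv⟩
    · refine ⟨t + 1, ?_⟩
      simpa only [add_assoc, add_comm 1] using ht
  · rintro ⟨t, ht⟩ I hI
    induction t generalizing v with
    | zero => exact hI (Or.inl ht)
    | succ t ih =>
      refine hI (Or.inr (ih (fun π => v π + 1) ?_))
      simpa only [add_assoc, add_comm 1] using ht

theorem mem_always_sem {ψ : MultiFormula AP N}
    (h : ∀ W W', ψ.sem (wordAssign w) W = ψ.sem (wordAssign w) W') :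
    v ∈ (always ψ).sem (wordAssign w) W ↔
      ∀ t : ℕ, (fun π => v π + t) ∈ ψ.sem (wordAssign w) W := by
  change ¬ v ∈ (eventually (.neg ψ)).sem (wordAssign w) W ↔ _
  rw [mem_eventually_sem w W v (fun W W' => by rw [sem, sem, h W W'])]
  simp [sem]

end MultiFormula

/-! ### The formula for space-time diagrams -/

section Diagram

open MultiFormula

variable {AP : Type}

/-- The trace of the second variable continues with the word `l`, blanks, and a delimiter. -/
def continuesWith (blank hash : AP) : List AP → MultiFormula AP (Fin 2)
  | [] => .next (fun _ => .neg (.atom blank)) (.test (.atom hash) 1)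
  | x :: l => step (and (.test (.atom x) 1) (continuesWith blank hash l))

/-- The second trace starts with a delimiter, blanks, the letter `start`, the word `l`, blanks, and
a delimiter. -/
def firstRow (blank hash start : AP) (l : List AP) : MultiFormula AP (Fin 2) :=
  and (.test (.atom hash) 1) (.next (fun _ => .neg (.atom blank))
    (and (.test (.atom start) 1) (continuesWith blank hash l)))

/-- The second trace is the first one without its first position. -/
noncomputable def shifted [Fintype AP] : MultiFormula AP (Fin 2) :=
  always (bigOr (Finset.univ.toList.map fun a : AP =>
    and (.test (.later 1 a) 0) (.test (.later 0 a) 1)))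

open Classical in
/-- A letter from `H` occurs on the second trace. -/
noncomputable def occurs [Fintype AP] (H : Set AP) : MultiFormula AP (Fin 2) :=
  eventually (bigOr ((Finset.univ.filter (· ∈ H)).toList.map fun a => .test (.later 0 a) 1))

open Classical in
/-- After moving the second position to the next delimiter, all windows belong to `R`. -/
noncomputable def windows [Fintype AP] (hash : AP) (R : Set (AP × AP × AP × AP)) : MultiFormula AP (Fin 2) :=
  .next ![.bot, .atom hash] (always (bigOr ((Finset.univ.filter (· ∈ R)).toList.map fun x =>
    and (and (.test (.later 0 x.1) 0) (.test (.later 1 x.2.1) 0))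
      (and (.test (.later 2 x.2.2.1) 0) (.test (.later 1 x.2.2.2) 1)))))

noncomputable def diagramFormula [Fintype AP] (blank hash : AP) (H : Set AP) (R : Set (AP × AP × AP × AP))
    (start : AP) (l : List AP) : HyperFormula AP (Fin 2) :=
  .ex 0 (.ex 1 (.body (and (and shifted (occurs H))
    (and (windows hash R) (firstRow blank hash start l)))))

/-! ### Closedness -/

theorem later_closed (i : ℕ) (a : AP) : (TraceFormula.later i a).Closed := by
  induction i with
  | zero => trivial
  | succ i ih =>
    rw [TraceFormula.later, Function.iterate_succ_apply']
    exact ih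

theorem bot_closed : (TraceFormula.bot : TraceFormula AP).Closed := by
  simp [TraceFormula.Closed, TraceFormula.bot, TraceFormula.ClosedIn]

theorem and_closedIn {N : Type} {B : Set N} {E O : Set ℕ} {ψ₁ ψ₂ : MultiFormula AP N}
    (h₁ : ψ₁.ClosedIn B E O) (h₂ : ψ₂.ClosedIn B E O) : (and ψ₁ ψ₂).ClosedIn B E O := ⟨h₁, h₂⟩

theorem bigOr_closedIn {N : Type} {B : Set N} {E O : Set ℕ} {l : List (MultiFormula AP N)}
    (h : ∀ ψ ∈ l, ψ.ClosedIn B E O) : (bigOr l).ClosedIn B E O := by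
  induction l with
  | nil => simp [bigOr, bot, MultiFormula.ClosedIn]
  | cons ψ l ih =>
    exact ⟨h ψ List.mem_cons_self, ih fun ψ' h' => h ψ' (List.mem_cons_of_mem _ h')⟩

theorem step_closedIn {N : Type} {B : Set N} {E O : Set ℕ} {ψ : MultiFormula AP N}
    (h : ψ.ClosedIn B E O) : (step ψ).ClosedIn B E O := ⟨fun _ => bot_closed, h⟩

theorem eventually_closedIn {N : Type} {B : Set N} {E O : Set ℕ} {ψ : MultiFormula AP N}
    (h : ψ.ClosedIn B (insert 0 E) (O \ {0})) : (eventually ψ).ClosedIn B E O :=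
  ⟨h, step_closedIn (Set.mem_insert _ _)⟩

theorem test_later_closedIn {N : Type} {B : Set N} {E O : Set ℕ} {i : ℕ} {a : AP} {π : N}
    (h : π ∈ B) : (test (.later i a) π : MultiFormula AP N).ClosedIn B E O :=
  ⟨later_closed i a, h⟩

theorem continuesWith_closedIn {blank hash : AP} {l : List AP} {B : Set (Fin 2)} {E O : Set ℕ}
    (h : 1 ∈ B) : (continuesWith blank hash l).ClosedIn B E O := by
  induction l with
  | nil => exact ⟨fun _ => trivial, trivial, h⟩
  | cons x l ih => exact step_closedIn (and_closedIn ⟨trivial, h⟩ ih)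

theorem diagramFormula_closed [Fintype AP] (blank hash : AP) (H : Set AP) (R : Set (AP × AP × AP × AP))
    (start : AP) (l : List AP) : (diagramFormula blank hash H R start l).Closed := by
  have h0 : (0 : Fin 2) ∈ insert (1 : Fin 2) (insert 0 ∅ : Set (Fin 2)) := by simp
  have h1 : (1 : Fin 2) ∈ insert (1 : Fin 2) (insert 0 ∅ : Set (Fin 2)) := by simp
  refine and_closedIn (and_closedIn ?_ ?_) (and_closedIn ⟨?_, ?_⟩ ?_)
  · refine eventually_closedIn (bigOr_closedIn fun ψ hψ => ?_)
    obtain ⟨a, -, rfl⟩ := List.mem_map.1 hψ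
    exact and_closedIn (test_later_closedIn h0) (test_later_closedIn h1)
  · refine eventually_closedIn (bigOr_closedIn fun ψ hψ => ?_)
    obtain ⟨a, -, rfl⟩ := List.mem_map.1 hψ
    exact test_later_closedIn h1
  · exact Fin.forall_fin_two.2 ⟨bot_closed, trivial⟩
  · refine eventually_closedIn (bigOr_closedIn fun ψ hψ => ?_)
    obtain ⟨a, -, rfl⟩ := List.mem_map.1 hψ
    exact and_closedIn (and_closedIn (test_later_closedIn h0) (test_later_closedIn h0))
      (and_closedIn (test_later_closedIn h0) (test_later_closedIn h1))
  · exact and_closedIn ⟨trivial, h1⟩ ⟨fun _ => trivial,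
      and_closedIn ⟨trivial, h1⟩ (continuesWith_closedIn h1)⟩

/-! ### Meaning -/

variable (w : Fin 2 → ℕ → AP) (W : ℕ → Set (Fin 2 → ℕ)) (v : Fin 2 → ℕ)

theorem mem_test_atom_sem (a : AP) (π : Fin 2) :
    v ∈ (test (.atom a) π).sem (wordAssign w) W ↔ a = w π (v π) :=
  mem_test_later_sem w W v 0 a π

theorem mem_shifted_sem [Fintype AP] : v ∈ shifted.sem (wordAssign w) W ↔
    ∀ t, w 0 (v 0 + t + 1) = w 1 (v 1 + t) := by
  rw [shifted, mem_always_sem]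
  · simp only [mem_bigOr_sem, List.mem_map, Finset.mem_toList, Finset.mem_univ, true_and,
      exists_exists_eq_and, mem_and_sem, mem_test_later_sem, add_zero]
    exact forall_congr' fun t => ⟨fun ⟨a, h1, h2⟩ => h1.symm.trans h2, fun h => ⟨_, rfl, h⟩⟩
  · intro W W'
    ext v
    simp [mem_bigOr_sem, mem_and_sem, mem_test_later_sem]

theorem mem_occurs_sem [Fintype AP] (H : Set AP) : v ∈ (occurs H).sem (wordAssign w) W ↔
    ∃ t, w 1 (v 1 + t) ∈ H := by
  rw [occurs, mem_eventually_sem]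
  · simp [mem_bigOr_sem, mem_test_later_sem]
  · intro W W'
    ext v
    simp [mem_bigOr_sem, mem_test_later_sem]

/-- The jump happens once, before `always`; all later moves are synchronous, so the offset between
the two positions is frozen. -/
theorem mem_windows_sem [Fintype AP] (hash : AP) (R : Set (AP × AP × AP × AP)) :
    v ∈ (windows hash R).sem (wordAssign w) W ↔ ∀ t, (w 0 (v 0 + 1 + t), w 0 (v 0 + 1 + t + 1),
      w 0 (v 0 + 1 + t + 2),
      w 1 ((TraceFormula.atom hash).succ (wordTrace (w 1)) (v 1) + t + 1)) ∈ R := by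
  rw [windows, sem, Set.mem_ofPred_eq, mem_always_sem]
  · simp only [mem_bigOr_sem, List.mem_map, Finset.mem_toList, Finset.mem_filter, Finset.mem_univ,
      true_and, exists_exists_and_eq_and, mem_and_sem, mem_test_later_sem]
    refine forall_congr' fun t => ⟨?_, fun h => ⟨_, h, ?_⟩⟩
    · rintro ⟨⟨a, b, c, d⟩, h, ⟨rfl, rfl⟩, rfl, rfl⟩
      simpa [succAssign, wordAssign, bot_succ] using h
    · simp [succAssign, wordAssign, bot_succ]
  · intro W W'
    ext v
    simp [mem_bigOr_sem, mem_and_sem, mem_test_later_sem]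

/-- The word `u` reads `l`, blanks, and a delimiter at place `L` after the place `x`. -/
def ReadsAfter (blank hash : AP) (u : ℕ → AP) (L x : ℕ) (l : List AP) : Prop :=
  (∀ i (hi : i < l.length), u (x + 1 + i) = l[i]) ∧ x + l.length < L ∧
    (∀ k, x + l.length < k → k < L → u k = blank) ∧ u L = hash

/-- The letters of `l` are read one step at a time and may themselves be blank; only the run of
blanks after them is skipped by a jump to the next non-blank letter. -/
theorem mem_continuesWith_sem {blank hash : AP} (hb : hash ≠ blank) (l : List AP) :
    v ∈ (continuesWith blank hash l).sem (wordAssign w) W ↔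
      ∃ L, ReadsAfter blank hash (w 1) L (v 1) l := by
  induction l generalizing v with
  | nil =>
    rw [continuesWith, sem, Set.mem_ofPred_eq, mem_test_atom_sem]
    simp only [succAssign, wordAssign, ReadsAfter, List.length_nil, not_lt_zero, IsEmpty.forall_iff,
      implies_true, true_and, add_zero]
    constructor
    · intro h
      -- The default successor does no harm: it leaves no position in between, and the test still
      -- demands a delimiter there.
      refine ⟨_, lt_succ _ _ _, fun k h1 h2 => ?_, h.symm⟩
      have := notMem_of_lt_succ h1 h2
      simpa [TraceFormula.sem, wordTrace, eq_comm] using this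
    · rintro ⟨L, h1, h2, h3⟩
      rw [succ_eq h1, h3]
      · simpa [TraceFormula.sem, wordTrace, h3] using hb.symm
      · intro k hk hk'
        simp [TraceFormula.sem, wordTrace, h2 k hk hk']
  | cons x l ih =>
    rw [continuesWith, mem_step_sem, mem_and_sem, mem_test_atom_sem, ih, ← exists_and_left]
    refine exists_congr fun L => ?_
    simp only [ReadsAfter, List.length_cons]
    rw [show v 1 + (l.length + 1) = v 1 + 1 + l.length by ring, ← and_assoc]
    refine and_congr_left' ⟨?_, fun h => ⟨?_, fun i hi => ?_⟩⟩
    · rintro ⟨rfl, h⟩ i hi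
      cases i with
      | zero => rfl
      | succ i =>
        rw [show v 1 + 1 + (i + 1) = v 1 + 1 + 1 + i by ring]
        exact h i (by omega)
    · exact (h 0 (by omega)).symm
    · rw [show v 1 + 1 + 1 + i = v 1 + 1 + (i + 1) by ring]
      exact h (i + 1) (by omega)

theorem mem_firstRow_sem {blank hash start : AP} (hb : hash ≠ blank) (hs : start ≠ blank)
    (l : List AP) : v ∈ (firstRow blank hash start l).sem (wordAssign w) W ↔
      w 1 (v 1) = hash ∧ ∃ p, v 1 < p ∧ (∀ k, v 1 < k → k < p → w 1 k = blank) ∧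
        w 1 p = start ∧ ∃ L, ReadsAfter blank hash (w 1) L p l := by
  rw [firstRow, mem_and_sem, mem_test_atom_sem, sem, Set.mem_ofPred_eq, mem_and_sem,
    mem_test_atom_sem, mem_continuesWith_sem w W _ hb]
  simp only [succAssign, wordAssign]
  refine and_congr eq_comm ⟨?_, ?_⟩
  · rintro ⟨h1, h2⟩
    refine ⟨_, lt_succ _ _ _, fun k h3 h4 => ?_, h1.symm, h2⟩
    have := notMem_of_lt_succ h3 h4
    simpa [TraceFormula.sem, wordTrace, eq_comm] using this
  · rintro ⟨p, h1, h2, h3, h4⟩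
    rw [succ_eq h1]
    · exact ⟨h3.symm, h4⟩
    · simpa [TraceFormula.sem, wordTrace, h3] using hs.symm
    · intro k hk hk'
      simp [TraceFormula.sem, wordTrace, h2 k hk hk']

theorem models_diagramFormula [Fintype AP] {blank hash start : AP} {l : List AP} (H : Set AP)
    (R : Set (AP × AP × AP × AP)) (hb : hash ≠ blank) (hs : start ≠ blank) (hsh : start ≠ hash)
    (hl : hash ∉ l) :
    Models (Set.range wordTrace) (diagramFormula blank hash H R start l) ↔
      ∃ u : ℕ → AP, ∃ L p, u 0 = hash ∧ 0 < p ∧ (∀ k, 0 < k → k < p → u k = blank) ∧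
        u p = start ∧ ReadsAfter blank hash u L p l ∧ (∃ t, u t ∈ H) ∧
        ∀ t, (u t, u (t + 1), u (t + 2), u (t + 1 + L)) ∈ R := by
  have hA : ∀ w₀ w₁ : ℕ → AP, Function.update
      (Function.update (fun _ => none : Assignment AP (Fin 2)) 0 (some (wordTrace w₀))) 1 (some (wordTrace w₁)) = wordAssign ![w₀, w₁] := by
    intro w₀ w₁
    funext π
    fin_cases π <;> simp [wordAssign]
  simp only [Models, diagramFormula, HyperFormula.Sat, Set.exists_range_iff, hA, mem_and_sem,
    mem_shifted_sem, mem_occurs_sem, mem_windows_sem, mem_firstRow_sem _ _ _ hb hs]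
  simp only [Matrix.cons_val_zero, Matrix.cons_val_one, zero_add]
  -- No letter strictly between 0 and `L` is a delimiter, so the jump in `windows` lands exactly at
  -- the end of the first row.
  have hL : ∀ (u : ℕ → AP) (L p : ℕ), 0 < p → (∀ k, 0 < k → k < p → u k = blank) →
      u p = start → ReadsAfter blank hash u L p l →
      (TraceFormula.atom hash).succ (wordTrace u) 0 = L := by
    rintro u L p h1 h2 h3 ⟨h4, h5, h6, h7⟩
    refine succ_eq (by omega) h7.symm fun k hk hk' hm => ?_
    replace hm : hash = u k := hm
    rcases lt_trichotomy k p with h | rfl | h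
    · exact hb (hm.trans (h2 k hk h))
    · exact hsh (h3.symm.trans hm.symm)
    · by_cases hkl : k ≤ p + l.length
      · refine hl ?_
        rw [hm, show k = p + 1 + (k - p - 1) by omega, h4 _ (by omega)]
        exact List.getElem_mem _
      · exact hb (hm.trans (h6 k (by omega) hk'))
  constructor
  · rintro ⟨w₀, u, ⟨h1, h2⟩, h3, h4, p, h5, h6, h7, L, h8⟩
    refine ⟨u, L, p, h4, h5, h6, h7, h8, h2, fun t => ?_⟩
    have := h3 t
    rw [hL u L p h5 h6 h7 h8, add_comm 1 t, h1, show t + 1 + 2 = t + 2 + 1 by ring, h1, h1] at this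
    rwa [show t + 1 + L = L + t + 1 by ring]
  · rintro ⟨u, L, p, h4, h5, h6, h7, h8, h2, h3⟩
    -- Truncated subtraction repeats `u 0` in front; no test ever reads the first trace at position
    -- 0.
    refine ⟨fun k => u (k - 1), u, ⟨fun t => rfl, h2⟩, fun t => ?_, h4, p, h5, h6, h7, L, h8⟩
    have := h3 t
    rw [show t + 1 + L = L + t + 1 by ring] at this
    rw [hL u L p h5 h6 h7 h8, add_comm 1 t]
    exact this

end Diagram
end HMu

namespace HMu
open Turing StateTransition

/-! ### Halting and the formula for space-time diagrams -/

section Reduction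

variable {Γ Q : Type} [Inhabited Γ]

def blankCell : Cell Γ Q := some (default, none)

def symCell (γ : Γ) : Cell Γ Q := some (γ, none)

variable [Inhabited Q]

def startCell (γ : Γ) : Cell Γ Q := some (γ, some default)

theorem mk₁_nth_of_neg (l : List Γ) {i : ℤ} (hi : i < 0) : (Tape.mk₁ l).nth i = default := by
  obtain ⟨n, rfl⟩ := Int.eq_negSucc_of_lt_zero hi
  change (ListBlank.mk []).nth n = default
  simp

theorem mk₁_nth_natCast (l : List Γ) (n : ℕ) : (Tape.mk₁ l).nth n = l.getI n := by
  rw [Tape.mk₁, Tape.mk₂, Tape.mk'_nth_nat, ListBlank.nth_mk]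

/-- The first row of a space-time diagram, described letter by letter. -/
theorem init_row_iff {x : Γ} {l : List Γ} {u : ℕ → Cell Γ Q} {L p : ℕ} (hp : 0 < p)
    (hL : p + l.length < L) :
    (∀ k ≤ L, u k = rowCell (TM0.init (x :: l)) p L k) ↔
      u 0 = none ∧ (∀ k, 0 < k → k < p → u k = blankCell) ∧ u p = startCell x ∧
        ReadsAfter blankCell none u L p (l.map symCell) := by
  have left : ∀ k, 0 < k → k < p → rowCell (TM0.init (x :: l)) p L k = (blankCell : Cell Γ Q) := by
    intro k h1 h2
    rw [rowCell_of_mem (by omega) (by omega), if_neg (by omega), TM0.init,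
      mk₁_nth_of_neg _ (by omega)]
    rfl
  have mid : rowCell (TM0.init (x :: l)) p L p = (startCell x : Cell Γ Q) := by
    rw [rowCell_of_mem (by omega) (by omega), if_pos rfl, sub_self, TM0.init]
    rfl
  have right : ∀ i, p + 1 + i < L → rowCell (TM0.init (x :: l)) p L ((p + 1 + i : ℕ) : ℤ) =
      (symCell (l.getI i) : Cell Γ Q) := by
    intro i h2
    rw [rowCell_of_mem (by omega) (by omega), if_neg (by omega), TM0.init,
      show ((p + 1 + i : ℕ) : ℤ) - p = (i + 1 : ℕ) by push_cast; ring, mk₁_nth_natCast]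
    rfl
  constructor
  · intro h
    refine ⟨by simpa [rowCell_zero] using h 0 (by omega), fun k h1 h2 => ?_, ?_, fun i hi => ?_, ?_,
      fun k h1 h2 => ?_, ?_⟩
    · rw [h k (by omega), left k h1 h2]
    · rw [h p (by omega), mid]
    · rw [List.length_map] at hi
      rw [h _ (by omega), right i (by omega), List.getI_eq_getElem _ hi, List.getElem_map]
    · rwa [List.length_map]
    · rw [List.length_map] at h1
      have := right (k - p - 1) (by omega)
      rw [show p + 1 + (k - p - 1) = k by omega, List.getI_eq_default _ (by omega)] at this
      rw [h k h2.le, this]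
      rfl
    · rw [h L le_rfl, rowCell_width]
  · rintro ⟨h0, h1, h2, h3, -, h4, h5⟩ k hk
    rw [List.length_map] at h4
    rcases Nat.eq_zero_or_pos k with rfl | hk0
    · rw [h0, Nat.cast_zero, rowCell_zero]
    rcases lt_trichotomy k p with hkp | rfl | hkp
    · rw [h1 k hk0 hkp, left k hk0 hkp]
    · rw [h2, mid]
    · rcases hk.eq_or_lt with rfl | hkL
      · rw [h5, rowCell_width]
      · obtain ⟨i, rfl⟩ : ∃ i, k = p + 1 + i := ⟨k - p - 1, by omega⟩
        rw [right i hkL]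
        by_cases hi : i < l.length
        · rw [h3 i (by rwa [List.length_map]), List.getI_eq_getElem _ hi, List.getElem_map]
        · rw [h4 _ (by omega) hkL, List.getI_eq_default _ (by omega)]
          rfl

/-- The instance of the model checking problem for a Turing machine on the input `x :: l`. -/
noncomputable def haltingFormula (M : TM0.Machine Γ Q) {m : ℕ} (e : Cell Γ Q ≃ Fin m) (x : Γ)
    (l : List Γ) : HyperFormula (Fin m) (Fin 2) :=
  diagramFormula (e blankCell) (e none) {c | CellHalts M (e.symm c)}
    {y | cellNext M (e.symm y.1) (e.symm y.2.1) (e.symm y.2.2.1) = some (e.symm y.2.2.2)}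
    (e (startCell x)) (l.map fun γ => e (symCell γ))

/-- The initial head letter carries a state, hence differs from the blank even if `x` is the blank
symbol, and no input letter is a delimiter. These are the side conditions of
`models_diagramFormula`. -/
theorem models_haltingFormula (M : TM0.Machine Γ Q) {m : ℕ} (e : Cell Γ Q ≃ Fin m) (x : Γ)
    (l : List Γ) : Models (Set.range wordTrace) (haltingFormula M e x l) ↔
      (eval (TM0.step M) (TM0.init (x :: l))).Dom := by
  rw [haltingFormula, models_diagramFormula _ _ (by simp [blankCell])
    (by simp [blankCell, startCell]) (by simp [startCell]) (by simp [symCell])]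
  have reads : ∀ (u : ℕ → Cell Γ Q) L p, ReadsAfter (e blankCell) (e none) (fun k => e (u k)) L p
      (l.map fun γ => e (symCell γ)) ↔ ReadsAfter blankCell none u L p (l.map symCell) := by
    intro u L p
    simp [ReadsAfter]
  -- Words over `Fin m` and words of cells correspond along `e`.
  have words : ∀ P : (ℕ → Fin m) → Prop, (∃ u, P u) ↔ ∃ u : ℕ → Cell Γ Q, P fun k => e (u k) :=
    fun P => ⟨fun ⟨u, h⟩ => ⟨fun k => e.symm (u k), by simpa using h⟩, fun ⟨u, h⟩ => ⟨_, h⟩⟩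
  rw [words]
  simp only [reads, Set.mem_ofPred_eq, Equiv.symm_apply_apply, EmbeddingLike.apply_eq_iff_eq]
  constructor
  · rintro ⟨u, L, p, h0, h1, h2, h3, h4, h5, h6⟩
    have hL : p + l.length < L := by simpa using h4.2.1
    exact IsDiagram.eval_dom (u := u) (L := L) (p := p)
      ⟨h1, by omega, (init_row_iff h1 hL).2 ⟨h0, h2, h3, h4⟩, h6, h5⟩
  · intro h
    obtain ⟨u, L, p, hd, hL⟩ := exists_isDiagram h l.length
    obtain ⟨h0, h2, h3, h4⟩ := (init_row_iff hd.pos hL).1 hd.init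
    exact ⟨u, L, p, h0, hd.pos, h2, h3, h4, hd.halts, hd.next⟩

/-! ### The reduction is computable -/

theorem primrec_code_and {m k : ℕ} {ψ₁ ψ₂ : ℕ → MultiFormula (Fin m) (Fin k)}
    (h₁ : Primrec fun n => (ψ₁ n).code) (h₂ : Primrec fun n => (ψ₂ n).code) :
    Primrec fun n => (MultiFormula.and (ψ₁ n) (ψ₂ n)).code :=
  Primrec₂.natPair.comp (Primrec.const 3) (Primrec₂.natPair.comp (Primrec.const 2)
    (Primrec₂.natPair.comp (Primrec₂.natPair.comp (Primrec.const 3) h₁)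
      (Primrec₂.natPair.comp (Primrec.const 3) h₂)))

theorem primrec_code_next {m k : ℕ} (Δ : Fin k → TraceFormula (Fin m))
    {ψ : ℕ → MultiFormula (Fin m) (Fin k)} (h : Primrec fun n => (ψ n).code) :
    Primrec fun n => (MultiFormula.next Δ (ψ n)).code :=
  Primrec₂.natPair.comp (Primrec.const 4) (Primrec₂.natPair.comp (Primrec.const _) h)

/-- Each further `c` wraps the code in the same fixed context `g`, so the code arises by primitive
recursion on `n`. -/
theorem primrec_code_continuesWith {m : ℕ} (blank hash b c : Fin m) :
    Primrec fun n => (continuesWith blank hash (b :: List.replicate n c)).code := by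
  refine primrec_code_next _ (primrec_code_and (Primrec.const _) ?_)
  let g : ℕ → ℕ → ℕ := fun _ y => Nat.pair 4 (Nat.pair
    (vecCode fun _ : Fin 2 => (TraceFormula.bot : TraceFormula (Fin m)).code)
    (Nat.pair 3 (Nat.pair 2 (Nat.pair
      (Nat.pair 3 (MultiFormula.test (.atom c) 1 : MultiFormula (Fin m) (Fin 2)).code)
      (Nat.pair 3 y)))))
  have hg : Primrec₂ g :=
    Primrec₂.natPair.comp (Primrec.const 4) (Primrec₂.natPair.comp (Primrec.const _)
      (Primrec₂.natPair.comp (Primrec.const 3) (Primrec₂.natPair.comp (Primrec.const 2)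
        (Primrec₂.natPair.comp (Primrec.const _) (Primrec₂.natPair.comp (Primrec.const 3)
          Primrec.snd)))))
  refine (Primrec.nat_rec₁ (continuesWith blank hash []).code hg).of_eq fun n => ?_
  induction n with
  | zero => rfl
  | succ n ih => exact congrArg (g n) ih

/-- The machine is fixed, so the conjuncts that were built by classical choice from its transition
table are constants; only the first row varies with `n`. -/
theorem primrec_code_haltingFormula (M : TM0.Machine Γ Q) {m : ℕ} (e : Cell Γ Q ≃ Fin m)
    (a b c : Γ) : Primrec fun n => (haltingFormula M e a (b :: List.replicate n c)).code := by
  have h : Primrec fun n => (continuesWith (e blankCell) (e none)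
      ((b :: List.replicate n c).map fun γ => e (symCell γ))).code := by
    simp only [List.map_cons, List.map_replicate]
    exact primrec_code_continuesWith _ _ _ _
  have h' := primrec_code_and (Primrec.const _) (primrec_code_next
    (fun _ => .neg (.atom (e blankCell)))
    (primrec_code_and (Primrec.const (MultiFormula.test (.atom (e (startCell a))) 1).code) h))
    (ψ₁ := fun _ => .test (.atom (e none)) 1)
  refine Primrec₂.natPair.comp (Primrec.const _) (Primrec₂.natPair.comp (Primrec.const _) ?_)
  refine Primrec₂.natPair.comp (Primrec.const _) (Primrec₂.natPair.comp (Primrec.const _) ?_)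
  exact Primrec₂.natPair.comp (Primrec.const _) (primrec_code_and (Primrec.const _)
    (primrec_code_and (Primrec.const _) h'))

end Reduction

/-! ### Model checking instances and the final reduction -/

/-- The Kripke structure whose traces are all words. -/
def completeKripke (m : ℕ) : KripkeStructure (Fin m) (Fin m) where
  init := Finset.univ
  trans := Finset.univ
  label s := {s}

theorem traceOf_completeKripke (m : ℕ) : (completeKripke m).traceOf = wordTrace := by
  funext p
  simp [KripkeStructure.traceOf, completeKripke, wordTrace]

theorem traces_completeKripke (m : ℕ) : (completeKripke m).traces = Set.range wordTrace := by
  have : (completeKripke m).paths = Set.univ := by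
    ext p
    simp [KripkeStructure.paths, completeKripke]
  rw [KripkeStructure.traces, this, traceOf_completeKripke, Set.image_univ]

theorem fairTraces_univ {AP S : Type} [Fintype S] (K : KripkeStructure AP S) :
    K.fairTraces Finset.univ = K.traces := by
  have : K.fairPaths Finset.univ = K.paths := by
    ext p
    simp only [KripkeStructure.fairPaths, Set.mem_ofPred_eq, Finset.mem_univ, and_iff_left_iff_imp]
    exact fun _ => Filter.frequently_true_iff_neBot _ |>.2 inferInstance
  rw [KripkeStructure.fairTraces, this, KripkeStructure.traces]

noncomputable def haltingInput {Γ Q : Type} [Inhabited Γ] [Inhabited Q] (M : TM0.Machine Γ Q)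
    {m : ℕ} (e : Cell Γ Q ≃ Fin m) (x : Γ) (l : List Γ) : Input where
  numAP := m
  numStates := m
  numVars := 2
  K := completeKripke m
  φ := haltingFormula M e x l
  closed := diagramFormula_closed _ _ _ _ _ _

theorem primrec_code_haltingInput {Γ Q : Type} [Inhabited Γ] [Inhabited Q] (M : TM0.Machine Γ Q)
    {m : ℕ} (e : Cell Γ Q ≃ Fin m) (a b c : Γ) :
    Primrec fun n => (haltingInput M e a (b :: List.replicate n c)).code := by
  have h : ∀ n, (haltingInput M e a (b :: List.replicate n c)).code = Nat.pair m (Nat.pair m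
      (Nat.pair 2 (Nat.pair (completeKripke m).code
        (haltingFormula M e a (b :: List.replicate n c)).code))) := fun n => rfl
  simp only [h]
  have hc : ∀ {f : ℕ → ℕ} (k : ℕ), Primrec f → Primrec fun n => Nat.pair k (f n) := fun k hf =>
    Primrec₂.natPair.comp (Primrec.const k) hf
  exact hc _ (hc _ (hc _ (hc _ (primrec_code_haltingFormula M e a b c))))

theorem models_haltingInput {Γ Q : Type} [Inhabited Γ] [Inhabited Q] (M : TM0.Machine Γ Q)
    {m : ℕ} (e : Cell Γ Q ≃ Fin m) (x : Γ) (l : List Γ) :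
    Models (haltingInput M e x l).K.traces (haltingInput M e x l).φ ↔
      (eval (TM0.step M) (TM0.init (x :: l))).Dom := by
  rw [← models_haltingFormula M e x l, ← traces_completeKripke]
  rfl

theorem not_decidableProblem_of_reduction {α : Type} {code : α → ℕ} {p : α → Prop} {q : ℕ → Prop}
    (hq : ¬ ComputablePred q) (I : ℕ → α) (hI : Computable fun n => code (I n))
    (h : ∀ n, p (I n) ↔ q n) : ¬ DecidableProblem code p := by
  rintro ⟨P, hP, hp⟩
  exact hq (ComputablePred.computable_of_manyOneReducible
    ⟨fun n => code (I n), hI, fun n => by rw [hp, h]⟩ hP)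

end HMu

theorem mainTheorem7 :
    ¬ HMu.DecidableProblem HMu.Input.code
        (fun I => HMu.Models I.K.traces I.φ) ∧
    ¬ HMu.DecidableProblem HMu.FairInput.code
        (fun I => HMu.Models (I.K.fairTraces I.F) I.φ) := by
  obtain ⟨Γ, Q, _, _, _, _, M, a, b, c, hund⟩ := HMu.exists_finite_TM0
  obtain ⟨m, ⟨e⟩⟩ := Finite.exists_equiv_fin (HMu.Cell Γ Q)
  let I : ℕ → HMu.Input := fun n => HMu.haltingInput M e a (b :: List.replicate n c)
  have hI : Computable fun n => (I n).code := (HMu.primrec_code_haltingInput M e a b c).to_comp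
  refine ⟨HMu.not_decidableProblem_of_reduction hund I hI
    fun n => HMu.models_haltingInput M e a (b :: List.replicate n c),
    HMu.not_decidableProblem_of_reduction hund (fun n => ⟨I n, Finset.univ⟩) ?_ fun n => ?_⟩
  · exact Primrec₂.natPair.to_comp.comp hI
      (Computable.const (HMu.finsetCode (Finset.univ : Finset (Fin m))))
  · rw [← HMu.models_haltingInput M e a (b :: List.replicate n c), HMu.fairTraces_univ]
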